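/- Let $X$ be a normed (Minkowski) plane, i.e. a two-dimensional real normed space with norm $\|\cdot\|$. For distinct points $K,L\in X$ let the inflection curve (the "Thales circle" of the segment $KL$ with respect to Birkhoff orthogonality) be $$\iota_{K,L}=\{P\in X:\ \overrightarrow{LP}\ \text{is normal to}\ \overrightarrow{KP}\}=\{P\in X:\ \|(P-K)+t(P-L)\|\ge\|P-K\|\ \text{for all } t\in\mathbb{R}\}.$$ 1. For every normed plane $X$ and all $K\neq L$ in $X$, $\iota_{K,L}$ is a (simple) closed curve, i.e. the image of a circle under an injective continuous map. 2. If, moreover, the unit circle of $X$ is smooth (there is exactly one supporting line of the unit ball at each point of the unit circle), then $\iota_{K,L}$ is starlike with respect to $K$: the closed region consisting of $\iota_{K,L}$ and the domain bounded by it is star-shaped with respect to $K$, and every open half-line starting at $K$ meets $\iota_{K,L}$ in at most one point. 3. In general, the domain bounded by $\iota_{K,L}$ is not convex, even if the unit circle is smooth: there are a normed plane with smooth unit circle and points $K\ne L$ in it for which the domain bounded by $\iota_{K,L}$ is not convex. 4. If, in a normed plane $X$, for all $K\ne L$ the curve $\iota_{K,L}$ is a Minkowski circle, i.e. $\iota_{K,L}=\{x:\|x-c\|=r\}$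 for some $c\in X$ and $r>0$ (which may depend on $K,L$), then $X$ is Euclidean, i.e. linearly isometric to $\mathbb{R}^2$ with its standard Euclidean norm. -/

import Mathlib

namespace NormedPlane

section Definitions

variable {X : Type*} [NormedAddCommGroup X] [NormedSpace ℝ X]

/-- Birkhoff orthogonality `x ⊥ y`: `‖x + t y‖ ≥ ‖x‖` for all real `t`. -/
def BirkhoffOrthogonal (x y : X) : Prop :=
  ∀ t : ℝ, ‖x‖ ≤ ‖x + t • y‖

/-- `y` is (Birkhoff) normal to `x`. The convention is that the tangent vectors at a point of a
circle are normal to the radius vector of this point, i.e. that the radius vector is Birkhoff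
orthogonal to them; for a compatible semi-inner product, linear in its first argument, this
says `[y, x] = 0`. -/
def IsNormalTo (y x : X) : Prop :=
  BirkhoffOrthogonal x y

/-- The inflection curve with pole `K` and inflection pole `L` (the Thales circle of the segment
`KL` for Birkhoff orthogonality): all points `P` such that the vector from `L` to `P` is normal to
the vector from `K` to `P`. -/
def inflectionCurve (K L : X) : Set X :=
  {P | IsNormalTo (P - L) (P - K)}

/-- A closed (Jordan) curve: the image of a circle under an injective continuous map. -/
def IsClosedCurve (C : Set X) : Prop :=
  ∃ γ : Circle → X, Continuous γ ∧ Function.Injective γ ∧ Set.range γ = C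

/-- The domain bounded by `C`: the points lying in bounded components of the complement
of `C`. -/
def domainBoundedBy (C : Set X) : Set X :=
  {x | x ∉ C ∧ Bornology.IsBounded (connectedComponentIn Cᶜ x)}

/-- The closed curve `C` is starlike with respect to the point `K`: the region consisting of `C`
and the domain it bounds is star-shaped with respect to `K`, and every open half-line that starts
at `K` meets `C` in at most one point. -/
def IsStarlikeCurve (K : X) (C : Set X) : Prop :=
  StarConvex ℝ K (C ∪ domainBoundedBy C) ∧
    ∀ v : X, v ≠ 0 → ∀ s t : ℝ, 0 < s → 0 < t → K + s • v ∈ C → K + t • v ∈ C → s = t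

/-- A Minkowski circle: a circle of positive radius with respect to the norm. -/
def IsMinkowskiCircle (C : Set X) : Prop :=
  ∃ (c : X) (r : ℝ), 0 < r ∧ C = Metric.sphere c r

end Definitions

/-- The unit circle is smooth: through each of its points `u` there is exactly one supporting line
`{x | f x = 1}` of the unit ball. -/
def SmoothUnitCircle (X : Type*) [NormedAddCommGroup X] [NormedSpace ℝ X] : Prop :=
  ∀ u : X, ‖u‖ = 1 → ∃! f : X →L[ℝ] ℝ, ‖f‖ = 1 ∧ f u = 1

end NormedPlane

namespace NormedPlane

open Filter Topology

/-! ### Birkhoff orthogonality along a hyperbola -/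

section Birkhoff

variable {X : Type*} [NormedAddCommGroup X] [NormedSpace ℝ X]

/-! Let `m` be the midpoint of the poles and `h = (L - K) / 2`. Then `m + a² v` lies on the curve
iff `a² v + h ⊥ a² v - h`; dividing by `a`, iff the hyperbola `b⁻¹ h + b v` has Birkhoff normal
tangent at `b = a`, which amounts to its norm being least there. The minimum exists by coercivity
(`ray_exists`) and is unique by a cosh-type gap (`ray_unique`). So every ray from `m` meets the
compact curve exactly once, and radial projection is a homeomorphism onto the circle.

In the smooth case the closed region is cut out by `f (P - K) ≤ f (L - K)`, with `f` norming `P - K`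
(`mem_union_domainBoundedBy_iff`). Since `f` is constant along rays from `K`, starlikeness follows.
An explicit curve in the ℓ⁴ plane is not convex.

If every curve is a circle, its center must be the midpoint, so Birkhoff and isosceles orthogonality
agree. The first is homogeneous, the second symmetric; together they make each vector orthogonal to
its quarter turn, which forces the norm to be constant on a Euclidean circle (`norm_cos_sin_eq`). -/

theorem BirkhoffOrthogonal.smul {x y : X} (h : BirkhoffOrthogonal x y) (a b : ℝ) :
    BirkhoffOrthogonal (a • x) (b • y) := by
  intro t
  rcases eq_or_ne a 0 with rfl | ha
  · simp
  · have : a • x + t • b • y = a • (x + (a⁻¹ * t * b) • y) := by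
      rw [smul_add, smul_smul, smul_smul]
      congr 2
      field_simp
    rw [this, norm_smul, norm_smul]
    exact mul_le_mul_of_nonneg_left (h _) (norm_nonneg _)

theorem birkhoffOrthogonal_of_functional {x y : X} {f : X →L[ℝ] ℝ} (hf : ‖f‖ = 1)
    (hx : f x = ‖x‖) (hy : f y = 0) : BirkhoffOrthogonal x y := by
  intro t
  have := f.le_opNorm (x + t • y)
  rw [map_add, map_smul, hy, hx, hf] at this
  simpa using this

/-- Orthogonality means that `x` keeps its norm modulo the line spanned by `y`; a norming functional
of its class, pulled back from the quotient, does the job. -/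
theorem BirkhoffOrthogonal.exists_functional {x y : X} (hx : x ≠ 0)
    (h : BirkhoffOrthogonal x y) :
    ∃ f : X →L[ℝ] ℝ, ‖f‖ = 1 ∧ f x = ‖x‖ ∧ f y = 0 := by
  set S : Submodule ℝ X := Submodule.span ℝ {y}
  have hq : ‖x‖ ≤ ‖(Submodule.Quotient.mk x : X ⧸ S)‖ := by
    refine le_of_forall_pos_lt_add fun ε hε => ?_
    obtain ⟨z, hz, hzn⟩ := Submodule.Quotient.norm_mk_lt (Submodule.Quotient.mk x : X ⧸ S) hε
    have : z - x ∈ S := (Submodule.Quotient.eq S).1 hz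
    obtain ⟨t, ht⟩ := Submodule.mem_span_singleton.1 this
    have : z = x + t • y := by rw [ht]; abel
    exact (h t).trans_lt (this ▸ hzn)
  obtain ⟨g, hg, hgx⟩ := exists_dual_vector'' ℝ (Submodule.Quotient.mk x : X ⧸ S)
  set π : X →L[ℝ] X ⧸ S := S.mkQ.mkContinuous 1
    (fun z => by simpa using Submodule.Quotient.norm_mk_le S z)
  have hπ : ∀ z, ‖π z‖ ≤ ‖z‖ := fun z => Submodule.Quotient.norm_mk_le S z
  have hx1 : (g.comp π) x = ‖x‖ := by
    change g (Submodule.Quotient.mk x) = _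
    rw [hgx]
    exact le_antisymm (hπ x) hq
  refine ⟨g.comp π, le_antisymm ?_ ?_, hx1, ?_⟩
  · refine ContinuousLinearMap.opNorm_le_bound _ zero_le_one fun z => ?_
    calc ‖g (π z)‖ ≤ ‖g‖ * ‖π z‖ := g.le_opNorm _
      _ ≤ 1 * ‖z‖ := mul_le_mul hg (hπ z) (norm_nonneg _) zero_le_one
  · have := (g.comp π).le_opNorm x
    rw [hx1, norm_norm] at this
    exact le_of_mul_le_mul_right (by simpa using this) (norm_pos_iff.2 hx)
  · have : π y = 0 := (Submodule.Quotient.mk_eq_zero S).2 (Submodule.mem_span_singleton_self y)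
    simp [this]

/-- In a smooth plane a norming functional of `x` vanishes on all `y` with `x ⊥ y`. -/
theorem BirkhoffOrthogonal.functional_eq_zero (hX : SmoothUnitCircle X) {x y : X} (hx : x ≠ 0)
    (h : BirkhoffOrthogonal x y) {f : X →L[ℝ] ℝ} (hf : ‖f‖ = 1) (hfx : f x = ‖x‖) : f y = 0 := by
  obtain ⟨g, hg, hgx, hgy⟩ := h.exists_functional hx
  have hn : ‖x‖ ≠ 0 := norm_ne_zero_iff.2 hx
  have := (hX (‖x‖⁻¹ • x) (by rw [norm_smul]; simp [hn])).unique (y₁ := f) (y₂ := g)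
    ⟨hf, by simp [hfx, hn]⟩ ⟨hg, by simp [hgx, hn]⟩
  rw [this, hgy]

/-- If `a⁻¹ h + a v` is Birkhoff orthogonal to the tangent of the hyperbola
`{b⁻¹ h + b v | b > 0}`, then it is, with a quantitative gap, its point of least norm. -/
theorem BirkhoffOrthogonal.mul_norm_hyperbola_le {h v : X} {a b : ℝ} (ha : 0 < a) (hb : 0 < b)
    (H : BirkhoffOrthogonal (a⁻¹ • h + a • v) (a • v - a⁻¹ • h)) :
    (a / b + b / a) / 2 * ‖a⁻¹ • h + a • v‖ ≤ ‖b⁻¹ • h + b • v‖ := by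
  have hc : 0 < (a / b + b / a) / 2 := by positivity
  -- With `τ = log (b / a)` the point at `b` is `cosh τ` times the point at `a` plus `sinh τ` times
  -- the tangent there.
  have key : b⁻¹ • h + b • v = ((a / b + b / a) / 2) •
      ((a⁻¹ • h + a • v) + (((b / a - a / b) / 2) / ((a / b + b / a) / 2)) •
        (a • v - a⁻¹ • h)) := by
    rw [smul_add, smul_smul, mul_div_cancel₀ _ hc.ne']
    match_scalars <;> (field_simp; ring)
  rw [key, norm_smul, Real.norm_of_nonneg hc.le]
  exact mul_le_mul_of_nonneg_left (H _) hc.le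

theorem birkhoffOrthogonal_sq_iff {h v : X} {a : ℝ} (ha : 0 < a) :
    BirkhoffOrthogonal (a ^ 2 • v + h) (a ^ 2 • v - h) ↔
      BirkhoffOrthogonal (a⁻¹ • h + a • v) (a • v - a⁻¹ • h) := by
  constructor
  · intro H
    convert H.smul a⁻¹ a⁻¹ using 1 <;> match_scalars <;> field_simp
  · intro H
    convert H.smul a a using 1 <;> match_scalars <;> field_simp

theorem half_div_add_div_ge_one {a b : ℝ} (ha : 0 < a) (hb : 0 < b) :
    1 ≤ (a / b + b / a) / 2 := by
  have : (a / b + b / a) / 2 - 1 = (a - b) ^ 2 / (2 * a * b) := by field_simp; ring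
  have : 0 ≤ (a - b) ^ 2 / (2 * a * b) := by positivity
  linarith

theorem one_lt_half_div_add_div {a b : ℝ} (ha : 0 < a) (hb : 0 < b) (hab : a ≠ b) :
    1 < (a / b + b / a) / 2 := by
  have : (a / b + b / a) / 2 - 1 = (a - b) ^ 2 / (2 * a * b) := by field_simp; ring
  have : 0 < (a - b) ^ 2 / (2 * a * b) := by
    have := sub_ne_zero.2 hab
    positivity
  linarith

theorem ray_unique {h v : X} (hh : h ≠ 0) {s t : ℝ} (hs : 0 < s) (ht : 0 < t)
    (Hs : BirkhoffOrthogonal (s • v + h) (s • v - h))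
    (Ht : BirkhoffOrthogonal (t • v + h) (t • v - h)) : s = t := by
  obtain ⟨a, ha, rfl⟩ : ∃ a : ℝ, 0 < a ∧ a ^ 2 = s := ⟨√s, Real.sqrt_pos.2 hs, Real.sq_sqrt hs.le⟩
  obtain ⟨b, hb, rfl⟩ : ∃ b : ℝ, 0 < b ∧ b ^ 2 = t := ⟨√t, Real.sqrt_pos.2 ht, Real.sq_sqrt ht.le⟩
  by_contra hne
  have hab : a ≠ b := fun e => hne (by rw [e])
  rw [birkhoffOrthogonal_sq_iff ha] at Hs
  rw [birkhoffOrthogonal_sq_iff hb] at Ht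
  have h1 := Hs.mul_norm_hyperbola_le ha hb
  have h2 := Ht.mul_norm_hyperbola_le hb ha
  rw [add_comm (b / a)] at h2
  have hc := one_lt_half_div_add_div ha hb hab
  set c := (a / b + b / a) / 2
  set x := a⁻¹ • h + a • v with hx
  set y := b⁻¹ • h + b • v with hy
  -- The two opposite gap inequalities leave only the degenerate case where both points are zero;
  -- eliminating `v` then rules it out.
  have hx0 : ‖x‖ = 0 := by nlinarith [norm_nonneg x, norm_nonneg y]
  have hy0 : ‖y‖ = 0 := by nlinarith [norm_nonneg x, norm_nonneg y]
  have : (b / a - a / b) • h = b • x - a • y := by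
    rw [hx, hy]
    (match_scalars <;> field_simp); ring
  rw [norm_eq_zero.1 hx0, norm_eq_zero.1 hy0, smul_zero, smul_zero, sub_zero,
    smul_eq_zero, or_iff_left hh, sub_eq_zero, div_eq_div_iff ha.ne' hb.ne'] at this
  exact hne (by nlinarith)

theorem tendsto_norm_hyperbola_atTop {h v : X} (hv : v ≠ 0) :
    Tendsto (fun τ : ℝ => ‖Real.exp (-τ) • h + Real.exp τ • v‖) atTop atTop := by
  have h1 : Tendsto (fun τ : ℝ => -(Real.exp (-τ) * ‖h‖)) atTop (𝓝 (-(0 * ‖h‖))) :=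
    ((Real.tendsto_exp_neg_atTop_nhds_zero).mul_const _).neg
  have h2 : Tendsto (fun τ : ℝ => Real.exp τ * ‖v‖) atTop atTop :=
    Real.tendsto_exp_atTop.atTop_mul_const (norm_pos_iff.2 hv)
  refine tendsto_atTop_mono (fun τ => ?_) (h2.atTop_add h1)
  have := norm_sub_norm_le (Real.exp τ • v) (-(Real.exp (-τ) • h))
  rw [sub_neg_eq_add, norm_neg, norm_smul, norm_smul, Real.norm_of_nonneg (Real.exp_pos _).le,
    Real.norm_of_nonneg (Real.exp_pos _).le, add_comm (Real.exp τ • v)] at this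
  linarith

theorem exists_min_norm_hyperbola {h v : X} (hh : h ≠ 0) (hv : v ≠ 0) :
    ∃ a : ℝ, 0 < a ∧ ∀ b : ℝ, 0 < b → ‖a⁻¹ • h + a • v‖ ≤ ‖b⁻¹ • h + b • v‖ := by
  have hcont : Continuous (fun τ : ℝ => ‖Real.exp (-τ) • h + Real.exp τ • v‖) := by fun_prop
  have hlim : Tendsto (fun τ : ℝ => ‖Real.exp (-τ) • h + Real.exp τ • v‖) (cocompact ℝ) atTop := by
    rw [cocompact_eq_atBot_atTop, tendsto_sup]
    refine ⟨?_, tendsto_norm_hyperbola_atTop hv⟩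
    have := (tendsto_norm_hyperbola_atTop (h := v) hh).comp tendsto_neg_atBot_atTop
    refine this.congr fun τ => ?_
    simp [add_comm]
  obtain ⟨τ, hτ⟩ := hcont.exists_forall_le hlim
  refine ⟨Real.exp τ, Real.exp_pos _, fun b hb => ?_⟩
  have := hτ (Real.log b)
  simpa [Real.exp_neg, Real.exp_log hb] using this

/-- A lower bound that is quadratically tight at `t = 0` already gives Birkhoff orthogonality. -/
theorem birkhoffOrthogonal_of_sqrt_bound {x y : X}
    (H : ∀ t : ℝ, |t| < 1 → √(1 - t ^ 2) * ‖x‖ ≤ ‖x + t • y‖) : BirkhoffOrthogonal x y := by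
  intro t
  by_contra! hlt
  set d := ‖x‖ - ‖x + t • y‖ with hd
  have hd0 : 0 < d := sub_pos.2 hlt
  have key : ∀ᶠ ε : ℝ in 𝓝[>] 0, d ≤ ε * t ^ 2 * ‖x‖ := by
    have e1 : ∀ᶠ ε : ℝ in 𝓝[>] 0, |ε * t| < 1 := by
      refine nhdsWithin_le_nhds ?_
      have : Tendsto (fun ε : ℝ => |ε * t|) (𝓝 0) (𝓝 |0 * t|) :=
        Continuous.tendsto (by fun_prop) 0
      exact this.eventually_lt_const (by simp)
    have e2 : ∀ᶠ ε : ℝ in 𝓝[>] 0, ε < 1 := nhdsWithin_le_nhds (gt_mem_nhds one_pos)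
    filter_upwards [e1, e2, self_mem_nhdsWithin] with ε h1 h2 (h3 : 0 < ε)
    have hsq : (ε * t) ^ 2 < 1 := (sq_lt_one_iff_abs_lt_one _).2 h1
    have l1 := H (ε * t) h1
    have l2 : 1 - (ε * t) ^ 2 ≤ √(1 - (ε * t) ^ 2) := by
      apply Real.le_sqrt_of_sq_le
      nlinarith [sq_nonneg (ε * t)]
    -- By convexity a deficit `d` at `t` gives a deficit of at least `ε d` at `ε t`, but the
    -- hypothesis allows only order `ε²`.
    have l3 : ‖x + (ε * t) • y‖ ≤ (1 - ε) * ‖x‖ + ε * ‖x + t • y‖ := by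
      have : x + (ε * t) • y = (1 - ε) • x + ε • (x + t • y) := by
        match_scalars <;> ring
      rw [this]
      refine (norm_add_le _ _).trans_eq ?_
      rw [norm_smul, norm_smul, Real.norm_of_nonneg h3.le, Real.norm_of_nonneg (by linarith)]
    have l4 := mul_le_mul_of_nonneg_right l2 (norm_nonneg x)
    have : ε * d ≤ ε * (ε * t ^ 2 * ‖x‖) := by rw [hd]; nlinarith
    exact le_of_mul_le_mul_left this h3
  have lim : Tendsto (fun ε : ℝ => ε * t ^ 2 * ‖x‖) (𝓝[>] 0) (𝓝 (0 * t ^ 2 * ‖x‖)) :=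
    (Continuous.tendsto (by fun_prop) 0).mono_left nhdsWithin_le_nhds
  have := ge_of_tendsto lim key
  simp only [zero_mul] at this
  linarith

theorem ray_exists {h v : X} (hh : h ≠ 0) (hv : v ≠ 0) :
    ∃ s : ℝ, 0 < s ∧ BirkhoffOrthogonal (s • v + h) (s • v - h) := by
  obtain ⟨a, ha, hmin⟩ := exists_min_norm_hyperbola hh hv
  refine ⟨a ^ 2, by positivity, (birkhoffOrthogonal_sq_iff ha).2 ?_⟩
  refine birkhoffOrthogonal_of_sqrt_bound fun t ht => ?_
  obtain ⟨h1, h2⟩ := abs_lt.1 ht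
  -- The tangent line at `a`, for `|t| < 1`, is the hyperbola point at `a p / q` scaled by `p q =
  -- √(1 - t²)`.
  set p := √(1 + t)
  set q := √(1 - t)
  have hp : 0 < p := Real.sqrt_pos.2 (by linarith)
  have hq : 0 < q := Real.sqrt_pos.2 (by linarith)
  have hp2 : p ^ 2 = 1 + t := Real.sq_sqrt (by linarith)
  have hq2 : q ^ 2 = 1 - t := Real.sq_sqrt (by linarith)
  have hpq : √(1 - t ^ 2) = p * q := by
    rw [show 1 - t ^ 2 = (p * q) ^ 2 by rw [mul_pow, hp2, hq2]; ring]
    exact Real.sqrt_sq (by positivity)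
  have : a⁻¹ • h + a • v + t • (a • v - a⁻¹ • h) =
      (p * q) • ((a * (p / q))⁻¹ • h + (a * (p / q)) • v) := by
    match_scalars
    · field_simp
      linarith
    · field_simp
      linarith
  rw [this, hpq, norm_smul, Real.norm_of_nonneg (by positivity)]
  exact mul_le_mul_of_nonneg_left (hmin _ (by positivity)) (by positivity)

end Birkhoff

/-! ### Curves met once by every ray from a point -/

section Starlike

variable {X : Type*} [NormedAddCommGroup X] [NormedSpace ℝ X]

theorem notMem_domainBoundedBy_of_ray {C : Set X} {q w : X} (hw : w ≠ 0)
    (h : ∀ r : ℝ, 0 ≤ r → q + r • w ∉ C) : q ∉ domainBoundedBy C := by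
  rintro ⟨-, hb⟩
  have hconn : IsPreconnected ((fun r : ℝ => q + r • w) '' Set.Ici 0) :=
    isPreconnected_Ici.image _ (by fun_prop)
  have hsub : (fun r : ℝ => q + r • w) '' Set.Ici 0 ⊆ connectedComponentIn Cᶜ q := by
    refine hconn.subset_connectedComponentIn ⟨0, by simp, by simp⟩ ?_
    rintro _ ⟨r, hr, rfl⟩
    exact h r hr
  obtain ⟨R, hR⟩ := (hb.subset hsub).exists_norm_le
  have hw' := norm_pos_iff.2 hw
  have hR0 : 0 ≤ R := (norm_nonneg _).trans (hR _ ⟨0, by simp, rfl⟩)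
  set r := (R + ‖q‖ + 1) / ‖w‖
  have hr : 0 ≤ r := by positivity
  have h1 := hR _ ⟨r, hr, rfl⟩
  have h2 := norm_sub_norm_le (r • w) (-q)
  rw [norm_smul, Real.norm_of_nonneg hr, div_mul_cancel₀ _ hw'.ne', sub_neg_eq_add, norm_neg,
    add_comm (r • w)] at h2
  linarith

/-- The radial inside `I` is compact, the radial outside `O` is closed, they cover the space and
meet only in `C`. Hence a component of the complement starting inside stays in bounded `I`, while a
point outside escapes along its ray. -/
theorem union_domainBoundedBy_eq {C : Set X} (hC : IsCompact C) {m : X} (hm : m ∉ C)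
    (huniq : ∀ v : X, v ≠ 0 → ∀ s t : ℝ, 0 < s → 0 < t → m + s • v ∈ C → m + t • v ∈ C → s = t)
    (hex : ∀ v : X, v ≠ 0 → ∃ s : ℝ, 0 < s ∧ m + s • v ∈ C) :
    C ∪ domainBoundedBy C = {q | q = m ∨ ∃ r : ℝ, 1 ≤ r ∧ m + r • (q - m) ∈ C} := by
  set I : Set X := {q | q = m ∨ ∃ r : ℝ, 1 ≤ r ∧ m + r • (q - m) ∈ C} with hI
  set O : Set X := {q | ∃ r : ℝ, r ∈ Set.Icc (0 : ℝ) 1 ∧ m + r • (q - m) ∈ C} with hO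
  have hIeq : I = insert m ((fun z : X × ℝ => m + z.2 • (z.1 - m)) '' (C ×ˢ Set.Icc 0 1)) := by
    ext q
    constructor
    · rintro (rfl | ⟨r, hr, hq⟩)
      · exact Set.mem_insert _ _
      · refine Or.inr ⟨(_, r⁻¹), ⟨hq, inv_nonneg.2 (by linarith), inv_le_one_of_one_le₀ hr⟩, ?_⟩
        have : r ≠ 0 := by linarith
        simp [smul_smul, this]
    · rintro (rfl | ⟨⟨p, s⟩, ⟨hp, hs0, hs1⟩, rfl⟩)
      · exact Or.inl rfl
      · rcases hs0.eq_or_lt with h0 | h0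
        · refine Or.inl ?_
          simp only at h0
          simp [← h0]
        · refine Or.inr ⟨s⁻¹, (one_le_inv₀ h0).2 hs1, ?_⟩
          simp only at h0 hp ⊢
          simpa [smul_smul, h0.ne'] using hp
  have hIcomp : IsCompact I := by
    rw [hIeq]
    exact ((hC.prod isCompact_Icc).image (by fun_prop)).insert m
  have hOclosed : IsClosed O := by
    have h1 : IsClosed {z : Set.Icc (0 : ℝ) 1 × X | m + (z.1 : ℝ) • (z.2 - m) ∈ C} :=
      hC.isClosed.preimage (by fun_prop)
    have h2 := isClosedMap_snd_of_compactSpace _ h1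
    convert h2 using 1
    ext q
    constructor
    · rintro ⟨r, hr, hq⟩
      exact ⟨(⟨r, hr⟩, q), hq, rfl⟩
    · rintro ⟨⟨r, q'⟩, hq, rfl⟩
      exact ⟨r, r.2, hq⟩
  have hinter : ∀ q, q ∈ I → q ∈ O → q ∈ C := by
    rintro q (rfl | ⟨r, hr, hq⟩) ⟨s, hs, hq'⟩
    · simp only [sub_self, smul_zero, add_zero] at hq'
      exact absurd hq' hm
    · have hqm : q - m ≠ 0 := fun e => hm (by simpa [e] using hq)
      have hs0 : 0 < s := hs.1.lt_of_ne fun e => hm (by simpa [← e] using hq')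
      have e := huniq _ hqm r s (by linarith) hs0 hq hq'
      have : r = 1 := le_antisymm (e ▸ hs.2) hr
      simpa [this] using hq
  have hunion : ∀ q, q ∈ I ∨ q ∈ O := by
    intro q
    rcases eq_or_ne q m with rfl | hqm
    · exact Or.inl (Or.inl rfl)
    · obtain ⟨s, hs, hq⟩ := hex _ (sub_ne_zero.2 hqm)
      rcases le_total 1 s with h | h
      · exact Or.inl (Or.inr ⟨s, h, hq⟩)
      · exact Or.inr ⟨s, ⟨hs.le, h⟩, hq⟩
  have hCI : C ⊆ I := fun q hq => Or.inr ⟨1, le_rfl, by simpa using hq⟩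
  have hCO : C ⊆ O := fun q hq => ⟨1, by simp, by simpa using hq⟩
  refine Set.Subset.antisymm (Set.union_subset hCI fun q hq => ?_) fun q hq => ?_
  · by_contra hqI
    have hqm : q ≠ m := fun e => hqI (Or.inl e)
    refine notMem_domainBoundedBy_of_ray (sub_ne_zero.2 hqm) (fun r hr hrC => ?_) hq
    refine hqI (Or.inr ⟨1 + r, by linarith, ?_⟩)
    convert hrC using 1
    module
  · by_cases hqC : q ∈ C
    · exact Or.inl hqC
    refine Or.inr ⟨hqC, ?_⟩
    have hsub : connectedComponentIn Cᶜ q ⊆ Oᶜ := by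
      refine isPreconnected_connectedComponentIn.subset_left_of_subset_union
        hOclosed.isOpen_compl hIcomp.isClosed.isOpen_compl ?_ ?_ ?_
      · rw [Set.disjoint_left]
        intro x hx hx'
        exact (hunion x).elim hx' hx
      · intro x hx
        have hxC : x ∉ C := connectedComponentIn_subset _ _ hx
        by_contra hcon
        simp only [Set.mem_union, Set.mem_compl_iff, not_or, not_not] at hcon
        exact hxC (hinter x hcon.2 hcon.1)
      · exact ⟨q, mem_connectedComponentIn hqC, fun hqO => hqC (hinter q hq hqO)⟩
    exact hIcomp.isBounded.subset fun x hx => (hunion x).resolve_right (hsub hx)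

/-- Radial projection from `m` is a continuous bijection from a compact space to the circle, so its
inverse is the parametrization. -/
theorem isClosedCurve_of_rays (hX : Module.finrank ℝ X = 2) {C : Set X} (hC : IsCompact C) {m : X}
    (hm : m ∉ C)
    (huniq : ∀ v : X, v ≠ 0 → ∀ s t : ℝ, 0 < s → 0 < t → m + s • v ∈ C → m + t • v ∈ C → s = t)
    (hex : ∀ v : X, v ≠ 0 → ∃ s : ℝ, 0 < s ∧ m + s • v ∈ C) : IsClosedCurve C := by
  have : FiniteDimensional ℝ X := FiniteDimensional.of_finrank_pos (by omega)
  let e : X ≃L[ℝ] ℂ := ContinuousLinearEquiv.ofFinrankEq (by rw [hX, Complex.finrank_real_complex])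
  have hne : ∀ p : C, ‖e (p - m)‖ ≠ 0 := by
    intro p h
    rw [norm_eq_zero, EmbeddingLike.map_eq_zero_iff, sub_eq_zero] at h
    exact hm (h ▸ p.2)
  let φ : C → Circle := fun p =>
    ⟨(‖e (p - m)‖⁻¹ : ℝ) • e (p - m), by
      have : ‖(‖e (p - m)‖⁻¹ : ℝ) • e (p - m)‖ = 1 := by
        rw [norm_smul, norm_inv, norm_norm, inv_mul_cancel₀ (hne p)]
      exact mem_sphere_zero_iff_norm.2 this⟩
  have hφ : Continuous φ := by
    refine Continuous.subtype_mk ?_ _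
    refine Continuous.smul (Continuous.inv₀ (by fun_prop) hne) (by fun_prop)
  have hinj : Function.Injective φ := by
    intro p q hpq
    have h1 : (‖e (p - m)‖⁻¹ : ℝ) • e (p - m) = (‖e (q - m)‖⁻¹ : ℝ) • e (q - m) :=
      congrArg Subtype.val hpq
    rw [← map_smul, ← map_smul] at h1
    have h2 := e.injective h1
    set v := (‖e (p - m)‖⁻¹ : ℝ) • ((p : X) - m) with hv
    have hp : m + ‖e (p - m)‖ • v = p := by rw [hv, smul_smul, mul_inv_cancel₀ (hne p)]; simp
    have hq : m + ‖e (q - m)‖ • v = q := by rw [h2, smul_smul, mul_inv_cancel₀ (hne q)]; simp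
    have hv0 : v ≠ 0 := fun h0 => hm (by rw [h0, smul_zero, add_zero] at hp; exact hp ▸ p.2)
    have := huniq v hv0 _ _ ((norm_nonneg _).lt_of_ne' (hne p)) ((norm_nonneg _).lt_of_ne' (hne q))
      (by rw [hp]; exact p.2) (by rw [hq]; exact q.2)
    exact Subtype.ext (by rw [← hp, ← hq, this])
  have hsurj : Function.Surjective φ := by
    intro z
    have hz : e.symm (z : ℂ) ≠ 0 := by simp
    obtain ⟨s, hs, hmem⟩ := hex _ hz
    refine ⟨⟨_, hmem⟩, Subtype.ext ?_⟩
    change (‖e (m + s • e.symm (z : ℂ) - m)‖⁻¹ : ℝ) • e (m + s • e.symm (z : ℂ) - m) = (z : ℂ)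
    rw [add_sub_cancel_left, map_smul, e.apply_symm_apply, norm_smul, Circle.norm_coe, mul_one,
      Real.norm_of_nonneg hs.le, smul_smul, inv_mul_cancel₀ hs.ne', one_smul]
  have : CompactSpace C := isCompact_iff_compactSpace.1 hC
  let F : C ≃ₜ Circle := Continuous.homeoOfEquivCompactToT2 (f := Equiv.ofBijective φ ⟨hinj, hsurj⟩) hφ
  refine ⟨Subtype.val ∘ F.symm, continuous_subtype_val.comp F.symm.continuous,
    Subtype.val_injective.comp F.symm.injective, ?_⟩
  rw [F.symm.surjective.range_comp, Subtype.range_coe]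

end Starlike

/-! ### Closedness and starlikeness of inflection curves -/

section InflectionCurve

variable {X : Type*} [NormedAddCommGroup X] [NormedSpace ℝ X]

theorem mem_inflectionCurve {K L P : X} :
    P ∈ inflectionCurve K L ↔ BirkhoffOrthogonal (P - K) (P - L) := Iff.rfl

theorem midpoint_add_mem_inflectionCurve {K L v : X} :
    midpoint ℝ K L + v ∈ inflectionCurve K L ↔
      BirkhoffOrthogonal (v + (2⁻¹ : ℝ) • (L - K)) (v - (2⁻¹ : ℝ) • (L - K)) := by
  rw [mem_inflectionCurve, midpoint_eq_smul_add, invOf_eq_inv]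
  have h1 : (2⁻¹ : ℝ) • (K + L) + v - K = v + (2⁻¹ : ℝ) • (L - K) := by
    match_scalars <;> norm_num
  have h2 : (2⁻¹ : ℝ) • (K + L) + v - L = v - (2⁻¹ : ℝ) • (L - K) := by
    match_scalars <;> norm_num
  rw [h1, h2]

theorem norm_sub_le_of_mem_inflectionCurve {K L P : X} (h : P ∈ inflectionCurve K L) :
    ‖P - K‖ ≤ ‖L - K‖ := by
  have := h (-1)
  simpa using this

theorem isCompact_inflectionCurve [ProperSpace X] (K L : X) : IsCompact (inflectionCurve K L) := by
  refine Metric.isCompact_of_isClosed_isBounded ?_ ?_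
  · have : inflectionCurve K L = ⋂ t : ℝ, {P | ‖P - K‖ ≤ ‖P - K + t • (P - L)‖} := by
      ext P
      simp [inflectionCurve, IsNormalTo, BirkhoffOrthogonal]
    rw [this]
    exact isClosed_iInter fun t => isClosed_le (by fun_prop) (by fun_prop)
  · refine Metric.isBounded_closedBall (x := K) (r := ‖L - K‖) |>.subset fun P hP => ?_
    rw [mem_closedBall_iff_norm]
    exact norm_sub_le_of_mem_inflectionCurve hP

theorem half_smul_sub_ne_zero {K L : X} (h : K ≠ L) : (2⁻¹ : ℝ) • (L - K) ≠ 0 :=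
  smul_ne_zero (by norm_num) (sub_ne_zero.2 h.symm)

theorem midpoint_notMem_inflectionCurve {K L : X} (h : K ≠ L) :
    midpoint ℝ K L ∉ inflectionCurve K L := by
  intro hm
  rw [← add_zero (midpoint ℝ K L), midpoint_add_mem_inflectionCurve] at hm
  have := hm 1
  simp only [zero_add, zero_sub, one_smul, add_neg_cancel, norm_zero] at this
  exact half_smul_sub_ne_zero h (norm_le_zero_iff.1 this)

theorem inflectionCurve_ray_unique {K L : X} (h : K ≠ L) (v : X) (_ : v ≠ 0) (s t : ℝ) (hs : 0 < s)
    (ht : 0 < t) (Hs : midpoint ℝ K L + s • v ∈ inflectionCurve K L)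
    (Ht : midpoint ℝ K L + t • v ∈ inflectionCurve K L) : s = t :=
  ray_unique (half_smul_sub_ne_zero h) hs ht (midpoint_add_mem_inflectionCurve.1 Hs)
    (midpoint_add_mem_inflectionCurve.1 Ht)

theorem inflectionCurve_ray_exists {K L : X} (h : K ≠ L) (v : X) (hv : v ≠ 0) :
    ∃ s : ℝ, 0 < s ∧ midpoint ℝ K L + s • v ∈ inflectionCurve K L := by
  obtain ⟨s, hs, H⟩ := ray_exists (half_smul_sub_ne_zero h) hv
  exact ⟨s, hs, midpoint_add_mem_inflectionCurve.2 H⟩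

theorem isClosedCurve_inflectionCurve (hX : Module.finrank ℝ X = 2) {K L : X} (h : K ≠ L) :
    IsClosedCurve (inflectionCurve K L) := by
  have : FiniteDimensional ℝ X := FiniteDimensional.of_finrank_pos (by omega)
  have : ProperSpace X := FiniteDimensional.proper ℝ X
  exact isClosedCurve_of_rays hX (isCompact_inflectionCurve K L)
    (midpoint_notMem_inflectionCurve h) (inflectionCurve_ray_unique h)
    (inflectionCurve_ray_exists h)

/-- In the smooth case, the closed region bounded by the inflection curve consists of the points
`P` such that the norming functional of `P - K` is at most as large at `P - K` as at `L - K`. -/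
theorem mem_union_domainBoundedBy_iff [ProperSpace X] (hS : SmoothUnitCircle X) {K L P : X}
    (h : K ≠ L) (hP : P ≠ K) {f : X →L[ℝ] ℝ} (hf : ‖f‖ = 1) (hfP : f (P - K) = ‖P - K‖) :
    P ∈ inflectionCurve K L ∪ domainBoundedBy (inflectionCurve K L) ↔ f (P - K) ≤ f (L - K) := by
  rw [union_domainBoundedBy_eq (isCompact_inflectionCurve K L)
    (midpoint_notMem_inflectionCurve h) (inflectionCurve_ray_unique h)
    (inflectionCurve_ray_exists h)]
  obtain ⟨v, rfl⟩ : ∃ v, P = midpoint ℝ K L + v := ⟨P - midpoint ℝ K L, by abel⟩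
  have hmem : ∀ r : ℝ, midpoint ℝ K L + r • v ∈ inflectionCurve K L ↔ _ := fun r =>
    midpoint_add_mem_inflectionCurve
  have hk0 := half_smul_sub_ne_zero h
  obtain ⟨k, hk⟩ : ∃ k, k = (2⁻¹ : ℝ) • (L - K) := ⟨_, rfl⟩
  rw [← hk] at hk0
  simp only [← hk] at hmem
  have e1 : midpoint ℝ K L + v - K = v + k := by
    rw [midpoint_eq_smul_add, invOf_eq_inv, hk]
    match_scalars <;> norm_num
  have e2 : L - K = (2 : ℝ) • k := by rw [hk, smul_smul]; norm_num
  have hvk : v + k ≠ 0 := by rw [← e1]; exact sub_ne_zero.2 hP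
  rw [e1] at hfP
  have hpos : 0 < f v + f k := by rw [← map_add, hfP]; exact norm_pos_iff.2 hvk
  rw [e1, e2, map_add, map_smul, smul_eq_mul]
  simp only [Set.mem_ofPred_eq, add_eq_left, add_sub_cancel_left]
  rcases eq_or_ne v 0 with rfl | hv
  · rw [map_zero, zero_add] at hpos
    simp only [true_or, map_zero, zero_add, true_iff]
    linarith
  obtain ⟨a, ha, H⟩ : ∃ a : ℝ, 0 < a ∧ BirkhoffOrthogonal (a ^ 2 • v + k) (a ^ 2 • v - k) := by
    obtain ⟨s, hs, H⟩ := ray_exists hk0 hv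
    exact ⟨√s, Real.sqrt_pos.2 hs, by rwa [Real.sq_sqrt hs.le]⟩
  have hstep : (v = 0 ∨ ∃ r : ℝ, 1 ≤ r ∧ midpoint ℝ K L + r • v ∈ inflectionCurve K L) ↔
      1 ≤ a := by
    constructor
    · rintro (h0 | ⟨r, hr, hr'⟩)
      · exact absurd h0 hv
      · rw [hmem] at hr'
        have := ray_unique hk0 (by linarith) (by positivity) hr' H
        by_contra! hlt
        nlinarith
    · intro h1
      exact Or.inr ⟨a ^ 2, by nlinarith, (hmem _).2 H⟩
  rw [hstep]
  -- Compare the least norm, at `a`, with the point `b = 1`, which `f` norms. The result says `(a -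
  -- 1) (a f v - f k) ≤ 0`.
  have hmin : a ^ 2 * f v + f k ≤ a * (f v + f k) := by
    have h1 := ((birkhoffOrthogonal_sq_iff ha).1 H).mul_norm_hyperbola_le ha one_pos
    have h2 := half_div_add_div_ge_one ha one_pos
    have h3 : ‖a⁻¹ • k + a • v‖ ≤ f v + f k := by
      rw [← map_add, hfP, add_comm v]
      simp only [inv_one, one_smul] at h1
      nlinarith [norm_nonneg (a⁻¹ • k + a • v)]
    have h4 := (le_abs_self _).trans (f.le_opNorm (a⁻¹ • k + a • v))
    rw [hf, one_mul, map_add, map_smul, map_smul, smul_eq_mul, smul_eq_mul] at h4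
    have h5 := mul_le_mul_of_nonneg_left (h4.trans h3) ha.le
    have h6 : a * (a⁻¹ * f k + a * f v) = a ^ 2 * f v + f k := by field_simp; ring
    rwa [h6] at h5
  constructor
  · intro h1
    by_contra! hlt
    rcases h1.eq_or_lt with rfl | h1
    -- Here the point is on the curve itself, and smoothness identifies `f` with the functional
    -- killing the tangent.
    · have := BirkhoffOrthogonal.functional_eq_zero hS hvk (by simpa using H) hf hfP
      rw [map_sub] at this
      linarith
    · have h2 : a * f v ≤ f k := by
        by_contra! h2
        nlinarith [mul_pos (sub_pos.2 h1) (sub_pos.2 h2)]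
      rcases le_or_gt 0 (f v) with h3 | h3
      · nlinarith
      · linarith
  · intro h1
    by_contra! hlt
    have h2 : f k ≤ a * f v := by
      by_contra! h2
      nlinarith [mul_pos (sub_pos.2 hlt) (sub_pos.2 h2)]
    have h3 : f v ≤ 0 := by
      by_contra! h3
      nlinarith
    have := mul_nonpos_of_nonneg_of_nonpos ha.le h3
    linarith

theorem isStarlikeCurve_inflectionCurve [ProperSpace X] (hS : SmoothUnitCircle X) {K L : X}
    (h : K ≠ L) : IsStarlikeCurve K (inflectionCurve K L) := by
  have hdual : ∀ x : X, x ≠ 0 → ∃ f : X →L[ℝ] ℝ, ‖f‖ = 1 ∧ f x = ‖x‖ := fun x hx => by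
    simpa using exists_dual_vector ℝ x (norm_ne_zero_iff.2 hx)
  constructor
  · rw [starConvex_iff_segment_subset]
    intro P hP Q hQ
    rw [segment_eq_image'] at hQ
    obtain ⟨c, ⟨hc0, hc1⟩, rfl⟩ := hQ
    simp only
    rcases eq_or_ne P K with rfl | hPK
    · simpa using hP
    rcases hc0.eq_or_lt with rfl | hc0
    · left
      simp [mem_inflectionCurve, BirkhoffOrthogonal]
    obtain ⟨f, hf, hfP⟩ := hdual _ (sub_ne_zero.2 hPK)
    rw [mem_union_domainBoundedBy_iff hS h hPK hf hfP] at hP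
    rw [mem_union_domainBoundedBy_iff hS h _ hf]
    · rw [add_sub_cancel_left, map_smul, smul_eq_mul]
      have : 0 ≤ f (P - K) := by rw [hfP]; exact norm_nonneg _
      nlinarith
    · rw [add_sub_cancel_left, map_smul, hfP, norm_smul, Real.norm_of_nonneg hc0.le, smul_eq_mul]
    · simpa [sub_eq_zero, hc0.ne'] using hPK
  · intro v hv s t hs ht Hs Ht
    obtain ⟨f, hf, hfv⟩ := hdual v hv
    have aux : ∀ r : ℝ, 0 < r → K + r • v ∈ inflectionCurve K L → r * ‖v‖ = f (L - K) := by
      intro r hr H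
      rw [mem_inflectionCurve, add_sub_cancel_left] at H
      have h0 := H.functional_eq_zero hS (smul_ne_zero hr.ne' hv) hf
        (by rw [map_smul, hfv, norm_smul, Real.norm_of_nonneg hr.le, smul_eq_mul])
      rw [show K + r • v - L = r • v - (L - K) by abel, map_sub, map_smul, hfv, smul_eq_mul] at h0
      linarith
    exact mul_right_cancel₀ (norm_ne_zero_iff.2 hv) ((aux s hs Hs).trans (aux t ht Ht).symm)

end InflectionCurve

/-! ### A nonconvex example in the smooth ℓ⁴ plane -/

section QuarticPlane

local instance : Fact ((1 : ENNReal) ≤ 4) := ⟨by norm_num⟩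

local notation "ℓ⁴" => PiLp 4 (fun _ : Fin 2 => ℝ)

theorem norm_pow_four (x : ℓ⁴) : ‖x‖ ^ 4 = x 0 ^ 4 + x 1 ^ 4 := by
  rw [PiLp.norm_eq_sum (by norm_num)]
  have h4 : (4 : ENNReal).toReal = ((4 : ℕ) : ℝ) := by norm_num
  rw [h4]
  simp only [Real.rpow_natCast, Fin.sum_univ_two, Real.norm_eq_abs, Even.pow_abs ⟨2, rfl⟩]
  rw [← Real.rpow_natCast, ← Real.rpow_mul (add_nonneg (Even.pow_nonneg ⟨2, rfl⟩ _) (Even.pow_nonneg ⟨2, rfl⟩ _))]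
  norm_num

/-- The first-order condition for a minimum at `t = 0`. -/
theorem quartic_critical {a b c d e g : ℝ} (h0 : a ^ 4 + c ^ 4 = e ^ 4)
    (h : ∀ t : ℝ, (e + t * g) ^ 4 ≤ (a + t * b) ^ 4 + (c + t * d) ^ 4) :
    a ^ 3 * b + c ^ 3 * d = e ^ 3 * g := by
  have hline : ∀ p q : ℝ, HasDerivAt (fun t : ℝ => (p + t * q) ^ 4) (4 * p ^ 3 * q) 0 := by
    intro p q
    have := (((hasDerivAt_id (0 : ℝ)).mul_const q).const_add p).pow 4
    simp only [id, zero_mul, add_zero, one_mul] at this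
    exact this
  have hd := ((hline a b).add (hline c d)).sub (hline e g)
  have hmin : IsLocalMin ((fun t : ℝ => (a + t * b) ^ 4) + (fun t : ℝ => (c + t * d) ^ 4) -
      fun t : ℝ => (e + t * g) ^ 4) 0 := by
    refine Filter.Eventually.of_forall fun t => ?_
    have := h t
    simp only [Pi.sub_apply, Pi.add_apply, zero_mul, add_zero]
    linarith
  have := hmin.hasDerivAt_eq_zero hd
  linarith

/-- `‖u + t w‖⁴ - f (u + t w)⁴` is least at `t = 0`, so the derivative there determines `f`; this
gives smoothness. -/
theorem quartic_functional {u : ℓ⁴} (hu : ‖u‖ = 1) {f : ℓ⁴ →L[ℝ] ℝ} (hf : ‖f‖ = 1) (hfu : f u = 1)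
    (w : ℓ⁴) : f w = u 0 ^ 3 * w 0 + u 1 ^ 3 * w 1 := by
  have h0 : u 0 ^ 4 + u 1 ^ 4 = (1 : ℝ) ^ 4 := by rw [← norm_pow_four, hu]
  have := quartic_critical (b := w 0) (d := w 1) (g := f w) h0 fun t => by
    have h1 := f.le_opNorm (u + t • w)
    rw [hf, one_mul, map_add, map_smul, hfu, Real.norm_eq_abs, smul_eq_mul] at h1
    have h2 := pow_le_pow_left₀ (abs_nonneg _) h1 4
    rw [Even.pow_abs ⟨2, rfl⟩, norm_pow_four] at h2
    simpa using h2
  linarith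

theorem smoothUnitCircle_quartic : SmoothUnitCircle ℓ⁴ := by
  intro u hu
  obtain ⟨f, hf, hfu⟩ := exists_dual_vector ℝ u (by simp [hu])
  have hfu' : f u = 1 := by simpa [hu] using hfu
  refine ⟨f, ⟨hf, hfu'⟩, fun g ⟨hg, hgu⟩ => ?_⟩
  ext w
  rw [quartic_functional hu hg hgu, quartic_functional hu hf hfu']

theorem birkhoffOrthogonal_quartic_iff (x y : ℓ⁴) :
    BirkhoffOrthogonal x y ↔ x 0 ^ 3 * y 0 + x 1 ^ 3 * y 1 = 0 := by
  constructor
  · intro h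
    have := quartic_critical (b := y 0) (d := y 1) (g := 0) (norm_pow_four x).symm fun t => by
      have h2 := pow_le_pow_left₀ (norm_nonneg _) (h t) 4
      rw [norm_pow_four (x + t • y)] at h2
      simpa using h2
    linarith
  · intro h t
    refine le_of_pow_le_pow_left₀ (n := 4) (by norm_num) (norm_nonneg _) ?_
    rw [norm_pow_four, norm_pow_four]
    have aux : ∀ p q : ℝ, p ^ 4 + 4 * p ^ 3 * q ≤ (p + q) ^ 4 := fun p q => by
      nlinarith [mul_nonneg (sq_nonneg q) (sq_nonneg (2 * p + q)),
        mul_nonneg (sq_nonneg q) (sq_nonneg p)]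
    have h1 := aux (x 0) (t * y 0)
    have h2 := aux (x 1) (t * y 1)
    simp only [PiLp.add_apply, PiLp.smul_apply, smul_eq_mul]
    linear_combination h1 + h2 - 4 * t * h

theorem mem_inflectionCurve_quartic_iff (P : ℓ⁴) :
    P ∈ inflectionCurve (0 : ℓ⁴) (WithLp.toLp 4 ![1, 1]) ↔
      P 0 ^ 3 * (P 0 - 1) + P 1 ^ 3 * (P 1 - 1) = 0 := by
  rw [mem_inflectionCurve, birkhoffOrthogonal_quartic_iff]
  simp

theorem mem_domainBoundedBy_quartic {P : ℓ⁴} (hP : P 0 ^ 3 * (P 0 - 1) + P 1 ^ 3 * (P 1 - 1) < 0) :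
    P ∈ domainBoundedBy (inflectionCurve (0 : ℓ⁴) (WithLp.toLp 4 ![1, 1])) := by
  set C := inflectionCurve (0 : ℓ⁴) (WithLp.toLp 4 ![1, 1])
  set G : ℓ⁴ → ℝ := fun P => P 0 ^ 3 * (P 0 - 1) + P 1 ^ 3 * (P 1 - 1) with hGdef
  have hG : Continuous G := by fun_prop
  have hPC : P ∉ C := fun h => hP.ne ((mem_inflectionCurve_quartic_iff P).1 h)
  refine ⟨hPC, ?_⟩
  -- `G` does not vanish off the curve, so it keeps its sign on the component; its negative set is
  -- bounded.
  have hsub : connectedComponentIn Cᶜ P ⊆ {Q | G Q < 0} := by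
    refine isPreconnected_connectedComponentIn.subset_left_of_subset_union
      (isOpen_lt hG continuous_const) (isOpen_lt (continuous_const (y := (0 : ℝ))) hG) ?_ ?_
      ⟨P, mem_connectedComponentIn hPC, hP⟩
    · rw [Set.disjoint_left]
      intro x (hx : G x < 0) (hx' : 0 < G x)
      linarith
    · intro x hx
      have hxC : x ∉ C := connectedComponentIn_subset _ _ hx
      exact lt_or_gt_of_ne fun h => hxC ((mem_inflectionCurve_quartic_iff x).2 h)
  refine (Metric.isBounded_closedBall (x := (0 : ℓ⁴)) (r := 2)).subset fun Q hQ => ?_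
  have hQ' : Q 0 ^ 3 * (Q 0 - 1) + Q 1 ^ 3 * (Q 1 - 1) < 0 := hsub hQ
  rw [mem_closedBall_zero_iff]
  refine le_of_pow_le_pow_left₀ (n := 4) (by norm_num) (by norm_num) ?_
  rw [norm_pow_four]
  have aux : ∀ x : ℝ, x ^ 4 ≤ 2 * (x ^ 3 * (x - 1)) + 2 := fun x => by
    nlinarith [sq_nonneg (x ^ 2 - x - 1), sq_nonneg (x - 1), sq_nonneg x, sq_nonneg (x ^ 2 - x)]
  have h0 := aux (Q 0)
  have h1 := aux (Q 1)
  norm_num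
  linarith

theorem not_convex_domainBoundedBy_quartic :
    ¬ Convex ℝ (domainBoundedBy (inflectionCurve (0 : ℓ⁴) (WithLp.toLp 4 ![1, 1]))) := by
  intro hconv
  -- The curve bulges past `x = 1` for `0 < y < 1`, but only to third order near `(1, 0)`. The
  -- midpoint `(51/50, 1/4)` of the two chosen points is therefore outside, and the horizontal ray
  -- from it avoids the curve.
  have hA : (WithLp.toLp 4 ![21 / 20, 1 / 2] : ℓ⁴) ∈
      domainBoundedBy (inflectionCurve (0 : ℓ⁴) (WithLp.toLp 4 ![1, 1])) :=
    mem_domainBoundedBy_quartic (by norm_num)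
  have hB : (WithLp.toLp 4 ![99 / 100, 0] : ℓ⁴) ∈
      domainBoundedBy (inflectionCurve (0 : ℓ⁴) (WithLp.toLp 4 ![1, 1])) :=
    mem_domainBoundedBy_quartic (by norm_num)
  have hM := hconv hA hB (a := 1 / 2) (b := 1 / 2) (by norm_num) (by norm_num) (by norm_num)
  refine notMem_domainBoundedBy_of_ray (w := (WithLp.toLp 4 ![1, 0] : ℓ⁴)) ?_ (fun r hr h => ?_) hM
  · intro h
    simpa using congrArg (fun x : ℓ⁴ => x 0) h
  · rw [mem_inflectionCurve_quartic_iff] at h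
    simp only [PiLp.add_apply, PiLp.smul_apply, smul_eq_mul, Matrix.cons_val_zero,
      Matrix.cons_val_one, mul_one, mul_zero, add_zero] at h
    norm_num at h
    have h1 : (51 / 50 + r) ^ 3 * (51 / 50 + r - 1) ≥ (51 / 50 : ℝ) ^ 3 * (51 / 50 - 1) := by
      have : (51 / 50 : ℝ) ^ 3 ≤ (51 / 50 + r) ^ 3 := pow_le_pow_left₀ (by norm_num) (by linarith) 3
      exact mul_le_mul this (by linarith) (by norm_num) (by positivity)
    norm_num at h1
    linarith

theorem exists_smooth_not_convex : ∃ (X : Type) (_ : NormedAddCommGroup X) (_ : NormedSpace ℝ X),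
    Module.finrank ℝ X = 2 ∧ SmoothUnitCircle X ∧
      ∃ K L : X, K ≠ L ∧ ¬ Convex ℝ (domainBoundedBy (inflectionCurve K L)) := by
  refine ⟨ℓ⁴, inferInstance, inferInstance, ?_, smoothUnitCircle_quartic, 0,
    WithLp.toLp 4 ![1, 1], fun h => ?_, not_convex_domainBoundedBy_quartic⟩
  · rw [(WithLp.linearEquiv 4 ℝ (Fin 2 → ℝ)).finrank_eq]
    simp
  · simpa using congrArg (fun x : ℓ⁴ => x 0) h

end QuarticPlane

/-! ### Circular inflection curves force a Euclidean norm -/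

section Circles

variable {X : Type*} [NormedAddCommGroup X] [NormedSpace ℝ X]

/-- If all inflection curves are circles, then the center is the midpoint of the poles. -/
theorem center_eq_of_inflectionCurve_eq_sphere {l c : X} {r : ℝ}
    (h : inflectionCurve 0 l = Metric.sphere c r) : l = (2 : ℝ) • c ∧ ‖l‖ = 2 * r := by
  have hmem : ∀ P : X, BirkhoffOrthogonal P (P - l) ↔ ‖P - c‖ = r := by
    intro P
    rw [← mem_sphere_iff_norm, ← h, mem_inflectionCurve, sub_zero]
  have hc : ‖c‖ = r := by
    have := (hmem 0).1 fun t => by simp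
    simpa using this
  have hl : ‖l - c‖ = r := (hmem l).1 fun t => by simp
  have h2c : BirkhoffOrthogonal ((2 : ℝ) • c) ((2 : ℝ) • c - l) :=
    (hmem _).2 (by rw [two_smul, add_sub_cancel_right, hc])
  have hlr : ‖l‖ = 2 * r := by
    refine le_antisymm ?_ ?_
    · have := norm_add_le (l - c) c
      rw [sub_add_cancel] at this
      linarith
    · have := h2c (-1)
      rw [norm_smul, hc] at this
      simpa using this
  refine ⟨?_, hlr⟩
  by_contra hne
  set w := (2 : ℝ) • c - l with hw
  have hw0 : w ≠ 0 := fun e => hne (sub_eq_zero.1 e).symm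
  have hlow : ∀ s : ℝ, 2 * r ≤ ‖l + s • w‖ := by
    intro s
    have := h2c (s - 1)
    rw [norm_smul, hc, show (2 : ℝ) • c + (s - 1) • w = l + s • w by rw [hw]; module] at this
    simpa using this
  -- A point of least norm on the line `l + s w` lies on the curve, hence at distance `r` from `c`;
  -- doubling its offset from `c` returns to the line. Iteration gives unboundedly many multiples of
  -- `w` at bounded norm.
  have hstep : ∀ s : ℝ, ‖l + s • w‖ = 2 * r → ‖l + (2 * s - 1) • w‖ = 2 * r := by
    intro s hs
    have h1 : BirkhoffOrthogonal (l + s • w) (l + s • w - l) := by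
      intro t
      rw [hs, show l + s • w + t • (l + s • w - l) = l + (s + t * s) • w by module]
      exact hlow _
    have h2 := (hmem _).1 h1
    rw [show l + (2 * s - 1) • w = (2 : ℝ) • (l + s • w - c) by rw [hw]; module, norm_smul, h2]
    norm_num
  have hiter : ∀ n : ℕ, ‖l + (1 - 2 ^ (n + 1) : ℝ) • w‖ = 2 * r := by
    intro n
    induction n with
    | zero =>
      rw [show l + (1 - 2 ^ (0 + 1) : ℝ) • w = (2 : ℝ) • (l - c) by rw [hw]; module, norm_smul, hl]
      norm_num
    | succ n ih =>
      convert hstep _ ih using 4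
      ring
  have hbound : ∀ n : ℕ, (2 ^ (n + 1) - 1 : ℝ) * ‖w‖ ≤ 4 * r := by
    intro n
    have h1 := norm_sub_le (l + (1 - 2 ^ (n + 1) : ℝ) • w) l
    have h2 : (1 : ℝ) ≤ 2 ^ (n + 1) := one_le_pow₀ (by norm_num)
    rw [hiter, hlr, add_sub_cancel_left, norm_smul, Real.norm_eq_abs, abs_sub_comm,
      abs_of_nonneg (by linarith)] at h1
    linarith
  obtain ⟨n, hn⟩ := pow_unbounded_of_one_lt (4 * r / ‖w‖ + 1) (one_lt_two (α := ℝ))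
  have h1 := hbound n
  have hwp := norm_pos_iff.2 hw0
  rw [← le_div_iff₀ hwp] at h1
  have : (2 : ℝ) ^ n ≤ 2 ^ (n + 1) := pow_le_pow_right₀ (by norm_num) (by omega)
  linarith

/-- If all inflection curves are circles, then Birkhoff and isosceles orthogonality coincide. -/
theorem birkhoffOrthogonal_iff_isosceles
    (H : ∀ K L : X, K ≠ L → IsMinkowskiCircle (inflectionCurve K L)) (x y : X) :
    BirkhoffOrthogonal x y ↔ ‖x + y‖ = ‖x - y‖ := by
  rcases eq_or_ne x y with rfl | hxy
  · rw [sub_self, norm_zero]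
    constructor
    · intro h
      have := h (-1)
      rw [neg_one_smul, add_neg_cancel, norm_zero, norm_le_zero_iff] at this
      simp [this]
    · intro h
      rw [norm_eq_zero, ← two_smul ℝ, smul_eq_zero] at h
      simp [h.resolve_left (by norm_num), BirkhoffOrthogonal]
  · obtain ⟨c, r, -, hC⟩ := H 0 (x - y) (sub_ne_zero.2 hxy).symm
    obtain ⟨h1, h2⟩ := center_eq_of_inflectionCurve_eq_sphere hC
    have h3 : BirkhoffOrthogonal x y ↔ ‖x - c‖ = r := by
      rw [← mem_sphere_iff_norm, ← hC, mem_inflectionCurve, sub_zero, sub_sub_cancel]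
    have h4 : x + y = (2 : ℝ) • (x - c) := by
      rw [smul_sub, ← h1]
      module
    rw [h3, h2, h4, norm_smul]
    norm_num

/-- Equal norms make `u + v` and `u - v` isosceles orthogonal; homogeneity of Birkhoff orthogonality
allows rescaling both before reading it back. -/
theorem norm_swap (H : ∀ x y : X, BirkhoffOrthogonal x y ↔ ‖x + y‖ = ‖x - y‖) {u v : X}
    (huv : ‖u‖ = ‖v‖) (a b : ℝ) : ‖a • u + b • v‖ = ‖b • u + a • v‖ := by
  have h1 : BirkhoffOrthogonal (u + v) (u - v) := by
    rw [H, show u + v + (u - v) = (2 : ℝ) • u by module,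
      show u + v - (u - v) = (2 : ℝ) • v by module, norm_smul, norm_smul, huv]
  have h2 := (H _ _).1 (h1.smul ((a + b) / 2) ((a - b) / 2))
  convert h2 using 2 <;> module

theorem norm_quarter_turn (H : ∀ x y : X, BirkhoffOrthogonal x y ↔ ‖x + y‖ = ‖x - y‖) {u v : X}
    (huv : ‖u‖ = ‖v‖) (h : BirkhoffOrthogonal u v) (a b : ℝ) :
    ‖a • u + b • v‖ = ‖(-b) • u + a • v‖ := by
  rw [norm_swap H huv a b, neg_smul, neg_add_eq_sub, (H _ _).1 (h.smul b a), norm_sub_rev]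

/-- The vector `a u + b v` is Birkhoff orthogonal to its quarter turn. -/
theorem birkhoffOrthogonal_quarter_turn
    (H : ∀ x y : X, BirkhoffOrthogonal x y ↔ ‖x + y‖ = ‖x - y‖) {u v : X}
    (huv : ‖u‖ = ‖v‖) (h : BirkhoffOrthogonal u v) (a b : ℝ) :
    BirkhoffOrthogonal (a • u + b • v) ((-b) • u + a • v) := by
  rw [H]
  have := norm_quarter_turn H huv h (a + b) (b - a)
  convert this.symm using 2 <;> module

/-- Rotation by `δ` moves along the tangent by `tan δ` and rescales by `cos δ`, so it shrinks the
norm at most by `cos δ`. Splitting a rotation into `n` small ones removes even this loss, and the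
reverse rotation gives equality. -/
theorem norm_cos_sin_eq {u v : X}
    (H : ∀ a b : ℝ, BirkhoffOrthogonal (a • u + b • v) ((-b) • u + a • v)) (θ : ℝ) :
    ‖Real.cos θ • u + Real.sin θ • v‖ = ‖u‖ := by
  set N : ℝ → ℝ := fun θ => ‖Real.cos θ • u + Real.sin θ • v‖ with hN
  have hstep : ∀ α δ : ℝ, |δ| < 1 → Real.cos δ * N α ≤ N (α + δ) := by
    intro α δ hδ
    obtain ⟨h1, h2⟩ := abs_lt.1 hδ
    have hpi := Real.pi_gt_three
    have hc : 0 < Real.cos δ := Real.cos_pos_of_mem_Ioo ⟨by linarith, by linarith⟩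
    have e : Real.cos (α + δ) • u + Real.sin (α + δ) • v =
        Real.cos δ • ((Real.cos α • u + Real.sin α • v) +
          (Real.sin δ / Real.cos δ) • ((-Real.sin α) • u + Real.cos α • v)) := by
      rw [Real.cos_add, Real.sin_add]
      (match_scalars <;> field_simp); ring
    simp only [hN]
    rw [e, norm_smul, Real.norm_of_nonneg hc.le]
    exact mul_le_mul_of_nonneg_left (H _ _ _) hc.le
  have hiter : ∀ (α δ : ℝ), |δ| < 1 → ∀ n : ℕ, Real.cos δ ^ n * N α ≤ N (α + n * δ) := by
    intro α δ hδ n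
    obtain ⟨h1, h2⟩ := abs_lt.1 hδ
    have hpi := Real.pi_gt_three
    have hc : 0 < Real.cos δ := Real.cos_pos_of_mem_Ioo ⟨by linarith, by linarith⟩
    induction n with
    | zero => simp
    | succ n ih =>
      have h3 := hstep (α + n * δ) δ hδ
      have h4 := mul_le_mul_of_nonneg_left ih hc.le
      rw [show α + ((n + 1 : ℕ) : ℝ) * δ = α + n * δ + δ by push_cast; ring, pow_succ']
      linarith
  have hmono : ∀ α δ : ℝ, N α ≤ N (α + δ) := by
    intro α δ
    have hlow : ∀ᶠ n : ℕ in atTop, (1 - δ ^ 2 / (n : ℝ)) * N α ≤ N (α + δ) := by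
      have hlarge : ∀ᶠ n : ℕ in atTop, |δ| + 1 < (n : ℝ) :=
        tendsto_natCast_atTop_atTop.eventually_gt_atTop _
      filter_upwards [hlarge] with n hn
      have hn0 : (0 : ℝ) < n := by linarith [abs_nonneg δ]
      have hd : |δ / n| < 1 := by
        rw [abs_div, abs_of_pos hn0, div_lt_one hn0]
        linarith
      have h1 := hiter α (δ / n) hd n
      rw [mul_div_cancel₀ _ hn0.ne'] at h1
      refine le_trans (mul_le_mul_of_nonneg_right ?_ (norm_nonneg _)) h1
      have h2 := Real.one_sub_sq_div_two_le_cos (x := δ / n)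
      have h3 : (δ / n) ^ 2 < 1 := (sq_lt_one_iff_abs_lt_one _).2 hd
      -- Bernoulli: `cos (δ / n) ^ n ≥ (1 - δ² / n²) ^ n ≥ 1 - δ² / n`.
      have h4 := one_add_mul_le_pow (a := -((δ / n) ^ 2)) (by linarith) n
      have h5 : (1 + -((δ / n) ^ 2)) ^ n ≤ Real.cos (δ / n) ^ n :=
        pow_le_pow_left₀ (by linarith) (by nlinarith [sq_nonneg (δ / n)]) n
      have h6 : (n : ℝ) * -((δ / n) ^ 2) = -(δ ^ 2 / n) := by field_simp
      linarith
    have hlim : Tendsto (fun n : ℕ => (1 - δ ^ 2 / (n : ℝ)) * N α) atTop (𝓝 ((1 - 0) * N α)) :=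
      (tendsto_const_nhds.sub (tendsto_const_div_atTop_nhds_zero_nat _)).mul_const _
    simpa using le_of_tendsto hlim hlow
  have h1 := hmono 0 θ
  have h2 := hmono θ (-θ)
  simp only [zero_add, add_neg_cancel] at h1 h2
  have h0 : N 0 = ‖u‖ := by simp [hN]
  rw [← h0]
  exact le_antisymm h2 h1

theorem norm_eq_sqrt_of_quarter_turn {u v : X} (hu : ‖u‖ = 1)
    (H : ∀ a b : ℝ, BirkhoffOrthogonal (a • u + b • v) ((-b) • u + a • v)) (a b : ℝ) :
    ‖a • u + b • v‖ = √(a ^ 2 + b ^ 2) := by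
  set z : ℂ := ⟨a, b⟩ with hz
  have h1 : a = ‖z‖ * Real.cos z.arg := (Complex.norm_mul_cos_arg z).symm
  have h2 : b = ‖z‖ * Real.sin z.arg := (Complex.norm_mul_sin_arg z).symm
  have h3 : ‖z‖ = √(a ^ 2 + b ^ 2) := by
    rw [Complex.norm_def, Complex.normSq_apply, hz, sq, sq]
  have h4 : a • u + b • v = ‖z‖ • (Real.cos z.arg • u + Real.sin z.arg • v) := by
    rw [smul_add, smul_smul, smul_smul, ← h1, ← h2]
  rw [h4, norm_smul, norm_cos_sin_eq H, hu, mul_one, norm_norm, h3]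

theorem exists_unit_birkhoffOrthogonal (hX : Module.finrank ℝ X = 2) :
    ∃ u v : X, ‖u‖ = 1 ∧ ‖v‖ = 1 ∧ BirkhoffOrthogonal u v := by
  have : FiniteDimensional ℝ X := FiniteDimensional.of_finrank_pos (by omega)
  have : Nontrivial X := Module.nontrivial_of_finrank_pos (R := ℝ) (by omega)
  obtain ⟨u, hu⟩ := exists_norm_eq X (zero_le_one (α := ℝ))
  obtain ⟨f, hf, hfu⟩ := exists_dual_vector ℝ u (by simp [hu])
  have hker : LinearMap.ker (f : X →ₗ[ℝ] ℝ) ≠ ⊥ := by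
    intro hbot
    have := LinearMap.finrank_le_finrank_of_injective (LinearMap.ker_eq_bot.1 hbot)
    rw [hX, Module.finrank_self] at this
    omega
  obtain ⟨w, hw, hw0⟩ := Submodule.exists_mem_ne_zero_of_ne_bot hker
  refine ⟨u, ‖w‖⁻¹ • w, hu, ?_, ?_⟩
  · rw [norm_smul, norm_inv, norm_norm, inv_mul_cancel₀ (norm_ne_zero_iff.2 hw0)]
  · refine birkhoffOrthogonal_of_functional hf (by simpa using hfu) ?_
    rw [map_smul, show f w = 0 from hw, smul_zero]

theorem nonempty_linearIsometryEquiv_of_circles (hX : Module.finrank ℝ X = 2)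
    (H : ∀ K L : X, K ≠ L → IsMinkowskiCircle (inflectionCurve K L)) :
    Nonempty (X ≃ₗᵢ[ℝ] EuclideanSpace ℝ (Fin 2)) := by
  obtain ⟨u, v, hu, hv, huv⟩ := exists_unit_birkhoffOrthogonal hX
  have hnorm := norm_eq_sqrt_of_quarter_turn hu
    (birkhoffOrthogonal_quarter_turn (birkhoffOrthogonal_iff_isosceles H) (hu.trans hv.symm) huv)
  let F : EuclideanSpace ℝ (Fin 2) →ₗ[ℝ] X :=
    { toFun := fun x => x 0 • u + x 1 • v
      map_add' := fun x y => by simp only [PiLp.add_apply]; module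
      map_smul' := fun c x => by
        simp only [PiLp.smul_apply, smul_eq_mul, RingHom.id_apply]; module }
  let G : EuclideanSpace ℝ (Fin 2) →ₗᵢ[ℝ] X :=
    ⟨F, fun x => by
      rw [EuclideanSpace.norm_eq, Fin.sum_univ_two, Real.norm_eq_abs, Real.norm_eq_abs, sq_abs,
        sq_abs]
      exact hnorm _ _⟩
  have : FiniteDimensional ℝ X := FiniteDimensional.of_finrank_pos (by omega)
  exact ⟨(G.toLinearIsometryEquiv (by rw [finrank_euclideanSpace_fin, hX])).symm⟩

end Circles

end NormedPlane

theorem mainTheorem5 :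
    (∀ (X : Type*) [NormedAddCommGroup X] [NormedSpace ℝ X], Module.finrank ℝ X = 2 →
      ∀ K L : X, K ≠ L →
        NormedPlane.IsClosedCurve (NormedPlane.inflectionCurve K L) ∧
        (NormedPlane.SmoothUnitCircle X →
          NormedPlane.IsStarlikeCurve K (NormedPlane.inflectionCurve K L))) ∧
    (∃ (X : Type) (_ : NormedAddCommGroup X) (_ : NormedSpace ℝ X),
      Module.finrank ℝ X = 2 ∧ NormedPlane.SmoothUnitCircle X ∧
      ∃ K L : X, K ≠ L ∧
        ¬ Convex ℝ (NormedPlane.domainBoundedBy (NormedPlane.inflectionCurve K L))) ∧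
    (∀ (X : Type*) [NormedAddCommGroup X] [NormedSpace ℝ X], Module.finrank ℝ X = 2 →
      (∀ K L : X, K ≠ L → NormedPlane.IsMinkowskiCircle (NormedPlane.inflectionCurve K L)) →
        Nonempty (X ≃ₗᵢ[ℝ] EuclideanSpace ℝ (Fin 2))) := by
  refine ⟨fun X _ _ hX K L hKL => ⟨NormedPlane.isClosedCurve_inflectionCurve hX hKL, fun hS => ?_⟩,
    NormedPlane.exists_smooth_not_convex,
    fun X _ _ hX H => NormedPlane.nonempty_linearIsometryEquiv_of_circles hX H⟩
  have : FiniteDimensional ℝ X := FiniteDimensional.of_finrank_pos (by omega)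
  have : ProperSpace X := FiniteDimensional.proper ℝ X
  exact NormedPlane.isStarlikeCurve_inflectionCurve hS hKL
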